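/- Let $H$ be an infinite-dimensional separable complex Hilbert space and let $A$, $B$ be (unbounded) selfadjoint operators on $H$ such that $D(A)\cap D(B)$ is dense, $D(AB)\cap D(BA)$ is dense, and $AB-BA$ is bounded on $D(AB)\cap D(BA)$. Let $C$ be the closure of $A+iB$ (defined on $D(A)\cap D(B)$), and let $\Delta$ be either $1+(A+iB)(A-iB)$ or $1+C^*C$, each on its natural domain. Assume that $\Delta$ has a compact inverse $\Delta^{-1}$ defined on all of $H$, and that for some $\varepsilon<1$ with $\frac{4\varepsilon-2\varepsilon^2}{(1-\varepsilon)^2}<\frac14$ one has $\|C^*C-CC^*\|<\varepsilon$, meaning that $C^*C=CC^*+X$ (with equality of domains) for a bounded operator $X$ on $H$ with $\|X\|<\varepsilon$. Let $$Q=\begin{pmatrix}\Delta^{-1} & C\Delta^{-1}\\ \Delta^{-1}C^* & 1-\Delta^{-1}\end{pmatrix}$$ be the corresponding bounded operator on $H\oplus H$, where $\Delta^{-1}C^*$ stands for its bounded extension $(C\Delta^{-1})^*$. For an orthonormal basis $e=(e_i)_{i\ge1}$ of $H$ and $N\ge 0$ let $L_N=\operatorname{span}(e_1,\dots,e_N)$,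 let $q_{11}=q_{11}(e,N)$ be the compression of $Q$ to $L_N\oplus L_N$, and let $M_N=M_N(e)$ be the number of eigenvalues of $q_{11}$ greater than $1/2$, counted with multiplicity. Then there is exactly one integer $\omega$ (denoted $\omega(A,B)$) with the following property: for every orthonormal basis $e$ of $H$ there is $N_0$ such that for all $N\ge N_0$ $$\|q_{11}^2-q_{11}\|<\tfrac14\qquad\text{and}\qquad M_N-N=\omega .$$ In particular $1/2$ is not an eigenvalue of $q_{11}$ for $N\geq N_0$, and the number $M_N-N$ depends neither on $N$, for $N$ large, nor on the choice of the basis. -/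

import Mathlib

open scoped InnerProductSpace

noncomputable section

namespace BottPair

open LinearPMap

variable {H : Type*} [NormedAddCommGroup H] [InnerProductSpace ℂ H]

/-- The composition `S T` of partially defined operators on its natural domain
`{x ∈ D(T) : T x ∈ D(S)}`. -/
def pcomp (S T : H →ₗ.[ℂ] H) : H →ₗ.[ℂ] H where
  domain := (S.domain.comap T.toFun).map T.domain.subtype
  toFun :=
    { toFun := fun x => S ⟨T ⟨x, by
          obtain ⟨y, -, hy⟩ := x.2
          exact hy ▸ y.2⟩, by
          obtain ⟨y, hy, hxy⟩ := x.2
          have : (⟨x, hxy ▸ y.2⟩ : T.domain) = y := Subtype.ext hxy.symm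
          rw [this]
          exact hy⟩
      map_add' := fun x y => by
        rw [← S.map_add]
        congr 1
        exact Subtype.ext (T.map_add ⟨x, _⟩ ⟨y, _⟩)
      map_smul' := fun c x => by
        rw [RingHom.id_apply, ← S.map_smul]
        congr 1
        exact Subtype.ext (T.map_smul c ⟨x, _⟩) }

theorem mem_pcomp_domain {S T : H →ₗ.[ℂ] H} {x : H} :
    x ∈ (pcomp S T).domain ↔ ∃ hx : x ∈ T.domain, T ⟨x, hx⟩ ∈ S.domain := by
  constructor
  · rintro ⟨y, hy, rfl⟩
    exact ⟨y.2, hy⟩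
  · rintro ⟨hx, h⟩
    exact ⟨⟨x, hx⟩, h, rfl⟩

/-- An everywhere defined linear map, as a partially defined operator with domain `⊤`. -/
def total (f : H →ₗ[ℂ] H) : H →ₗ.[ℂ] H := f.toPMap ⊤

/-- The bounded operator `R` is the inverse of the partially defined operator `T`. -/
def IsInverse (T : H →ₗ.[ℂ] H) (R : H →L[ℂ] H) : Prop :=
  (∀ y, ∃ h : R y ∈ T.domain, T ⟨R y, h⟩ = y) ∧ ∀ x : T.domain, R (T x) = x

/-- `A + iB` on `D(A) ∩ D(B)`. -/
def plus (A B : H →ₗ.[ℂ] H) : H →ₗ.[ℂ] H := A + Complex.I • B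

/-- `A - iB` on `D(A) ∩ D(B)`. -/
def minus (A B : H →ₗ.[ℂ] H) : H →ₗ.[ℂ] H := A - Complex.I • B

/-- `C`, the closure of `A + iB`. -/
def opC (A B : H →ₗ.[ℂ] H) : H →ₗ.[ℂ] H := (plus A B).closure

/-- `AB - BA` on `D(AB) ∩ D(BA)`. -/
def comm (A B : H →ₗ.[ℂ] H) : H →ₗ.[ℂ] H := pcomp A B - pcomp B A

/-- `1 + (A + iB)(A - iB)`. -/
def delta (A B : H →ₗ.[ℂ] H) : H →ₗ.[ℂ] H :=
  total LinearMap.id + pcomp (plus A B) (minus A B)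

variable [CompleteSpace H]

/-- `1 + C*C`. -/
def delta' (A B : H →ₗ.[ℂ] H) : H →ₗ.[ℂ] H :=
  total LinearMap.id + pcomp (opC A B)† (opC A B)

/-- Pairs of selfadjoint operators with dense `D(A) ∩ D(B)`, dense `D(AB) ∩ D(BA)`
and bounded `AB - BA`. -/
structure IsPair (A B : H →ₗ.[ℂ] H) : Prop where
  selfAdjoint_left : IsSelfAdjoint A
  selfAdjoint_right : IsSelfAdjoint B
  dense_inter : Dense ((A.domain ⊓ B.domain : Submodule ℂ H) : Set H)
  dense_comm : Dense ((comm A B).domain : Set H)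
  bounded_comm : ∃ c : ℝ, ∀ x : (comm A B).domain, ‖comm A B x‖ ≤ c * ‖(x : H)‖

/-- `‖C*C - CC*‖ < ε`: the operators `C*C` and `CC*` have the same domain and differ there
by a bounded operator on `H` of norm less than `ε`. -/
def SelfCommLT (C : H →ₗ.[ℂ] H) (ε : ℝ) : Prop :=
  ∃ X : H →L[ℂ] H, ‖X‖ < ε ∧ pcomp C† C = pcomp C C† + total (X : H →ₗ[ℂ] H)

theorem plus_le_adjoint {A B : H →ₗ.[ℂ] H} (h : IsPair A B) : plus A B ≤ (minus A B)† := by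
  have hA := adjoint_isFormalAdjoint h.selfAdjoint_left.dense_domain
  have hB := adjoint_isFormalAdjoint h.selfAdjoint_right.dense_domain
  rw [isSelfAdjoint_def.1 h.selfAdjoint_left] at hA
  rw [isSelfAdjoint_def.1 h.selfAdjoint_right] at hB
  refine IsFormalAdjoint.le_adjoint h.dense_inter fun x y => ?_
  have e1 : minus A B x = A ⟨x, x.2.1⟩ - Complex.I • B ⟨x, x.2.2⟩ := rfl
  have e2 : plus A B y = A ⟨y, y.2.1⟩ + Complex.I • B ⟨y, y.2.2⟩ := rfl
  have e3 := hA ⟨x, x.2.1⟩ ⟨y, y.2.1⟩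
  have e4 := hB ⟨x, x.2.2⟩ ⟨y, y.2.2⟩
  simp only at e3 e4
  rw [e1, e2, inner_sub_left, inner_add_right, inner_smul_left, inner_smul_right, e3, e4]
  simp

theorem opC_isClosed {A B : H →ₗ.[ℂ] H} (h : IsPair A B) : (opC A B).IsClosed :=
  ((adjoint_isClosed (T := minus A B) h.dense_inter).isClosable.leIsClosable
    (plus_le_adjoint h)).closure_isClosed

theorem inverse_mem_opC {A B Δ : H →ₗ.[ℂ] H} {R : H →L[ℂ] H}
    (hΔ : Δ = delta A B ∨ Δ = delta' A B) (hR : IsInverse Δ R) (y : H) :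
    R y ∈ (opC A B).domain := by
  obtain ⟨h, -⟩ := hR.1 y
  rcases hΔ with rfl | rfl
  · exact (le_closure (plus A B)).1 (mem_pcomp_domain.1 h.2).1
  · exact (mem_pcomp_domain.1 h.2).1

/-- The bounded operator `C R`, for a closed operator `C` and a bounded operator `R` with range
in `D(C)` (bounded by the closed graph theorem). -/
def closedComp (C : H →ₗ.[ℂ] H) (R : H →L[ℂ] H) (hC : C.IsClosed) (h : ∀ y, R y ∈ C.domain) :
    H →L[ℂ] H :=
  ContinuousLinearMap.ofIsClosedGraph
    (g := C.toFun.comp ((R : H →ₗ[ℂ] H).codRestrict C.domain h)) (by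
      have hc : Continuous fun p : H × H => (R p.1, p.2) := by fun_prop
      convert IsClosed.preimage hc hC using 1
      ext ⟨x, y⟩
      simp only [SetLike.mem_coe, LinearMap.mem_graph_iff, Set.mem_preimage, mem_graph_iff]
      constructor
      · rintro rfl
        exact ⟨⟨R x, h x⟩, rfl, rfl⟩
      · rintro ⟨z, hz, rfl⟩
        have : z = ⟨R x, h x⟩ := Subtype.ext hz
        rw [this]
        rfl)

theorem closedComp_apply (C : H →ₗ.[ℂ] H) (R : H →L[ℂ] H) (hC : C.IsClosed)
    (h : ∀ y, R y ∈ C.domain) (y : H) : closedComp C R hC h y = C ⟨R y, h y⟩ := rfl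

/-- The operator on `H ⊕ H` with the block matrix `(a, b; c, d)`. -/
def block (a b c d : H →L[ℂ] H) : WithLp 2 (H × H) →L[ℂ] WithLp 2 (H × H) :=
  (WithLp.prodContinuousLinearEquiv 2 ℂ H H).symm.toContinuousLinearMap ∘L
    ((a.coprod b).prod (c.coprod d)) ∘L
      (WithLp.prodContinuousLinearEquiv 2 ℂ H H).toContinuousLinearMap

/-- `Q = (Δ⁻¹, CΔ⁻¹; Δ⁻¹C*, 1 - Δ⁻¹)` with `R = Δ⁻¹`. The entry `Δ⁻¹C*` is only defined on
`D(C*)`; as a bounded operator on `H` it is the adjoint of `CΔ⁻¹`. -/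
def bottQ {A B Δ : H →ₗ.[ℂ] H} {R : H →L[ℂ] H} (hAB : IsPair A B)
    (hΔ : Δ = delta A B ∨ Δ = delta' A B) (hR : IsInverse Δ R) :
    WithLp 2 (H × H) →L[ℂ] WithLp 2 (H × H) :=
  let S := closedComp (opC A B) R (opC_isClosed hAB) (inverse_mem_opC hΔ hR)
  block R S (ContinuousLinearMap.adjoint S) (1 - R)

/-- `L_N`, the span of the first `N` vectors of the basis. -/
def firstSpan (e : HilbertBasis ℕ ℂ H) (N : ℕ) : Submodule ℂ H :=
  Submodule.span ℂ (e '' Set.Iio N)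

/-- `L_N ⊕ L_N` inside `H ⊕ H`. -/
def doubleSpan (e : HilbertBasis ℕ ℂ H) (N : ℕ) : Submodule ℂ (WithLp 2 (H × H)) :=
  ((firstSpan e N).prod (firstSpan e N)).map (WithLp.linearEquiv 2 ℂ (H × H)).symm.toLinearMap

instance (e : HilbertBasis ℕ ℂ H) (N : ℕ) : FiniteDimensional ℂ (doubleSpan e N) := by
  have h1 : (firstSpan e N).FG := Submodule.fg_span ((Set.finite_Iio N).image _)
  exact Module.Finite.iff_fg.2 ((h1.prod h1).map _)

/-- The compression `q₁₁` of an operator on `H ⊕ H` to `L_N ⊕ L_N`. -/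
def compress (Q : WithLp 2 (H × H) →L[ℂ] WithLp 2 (H × H)) (e : HilbertBasis ℕ ℂ H) (N : ℕ) :
    doubleSpan e N →L[ℂ] doubleSpan e N :=
  (doubleSpan e N).orthogonalProjectionOnto ∘L Q ∘L (doubleSpan e N).subtypeL

/-- The number of eigenvalues greater than `1/2`, with multiplicity, of a selfadjoint operator
on a finite-dimensional space: the dimension of the span of the corresponding eigenvectors. -/
def countAboveHalf {V : Type*} [AddCommGroup V] [Module ℂ V] (q : V →ₗ[ℂ] V) : ℕ :=
  Module.finrank ℂ (⨆ μ ∈ Set.Ioi (1 / 2 : ℝ), Module.End.eigenspace q (μ : ℂ) : Submodule ℂ V)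

end BottPair

end

open scoped InnerProductSpace

noncomputable section

namespace BottPair

/-! ### Two-by-two operator matrices on `H ⊕ H`. -/

section Blocks

variable {H : Type*} [NormedAddCommGroup H] [InnerProductSpace ℂ H]

/-! Put R = Δ⁻¹ and S = CR. If C*C and CC* were equal, R and S would commute, S*S and SS* would both
be R - R², and Q would be a projection. A discrepancy X with ‖X‖ < ε spoils these identities only by
O(ε), which gives ‖Q² - Q‖ ≤ 4ε < 1/4. This is `norm_blockQ_sq_sub_le_of_isResolvent` for Δ = 1 +
C*C and `norm_blockQ_sq_sub_le_of_isResolvent_dual` for Δ = 1 + (A+iB)(A-iB), an operator contained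
in 1 + CC*. The resolvent on the other side comes from a Neumann series (`IsResolvent.exists_dual`,
`IsResolvent.exists_of_dual`). The resolvent algebra is phrased with graphs, so that domains need no
bookkeeping.

Compactness of R forces that of S, so Q = E + K with E the projection onto the second summand and K
compact and selfadjoint. As E commutes with the projections onto L_N ⊕ L_N, and the compressions of
K converge to K in norm, q₁₁² - q₁₁ stays below 1/4 for large N and the spectrum of q₁₁ has a gap at
1/2.

The count M_N - N is compared directly for any two bases and any two large cutoffs
(`finrank_add_finrank_le`). The form of Q is above 1/2 on one subspace, enlarged by directions where
E = 1, and essentially at most 1/2 on another, enlarged by directions where E = 0. The two enlarged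
spaces are disjoint, and counting dimensions gives M_N - N ≤ M'_N' - N'. Exchanging the roles gives
equality. -/

theorem block_apply (a b c d : H →L[ℂ] H) (x : WithLp 2 (H × H)) :
    block a b c d x = WithLp.toLp 2 (a x.fst + b x.snd, c x.fst + d x.snd) := rfl

theorem block_mul (a b c d a' b' c' d' : H →L[ℂ] H) :
    block a b c d * block a' b' c' d' =
      block (a * a' + b * c') (a * b' + b * d') (c * a' + d * c') (c * b' + d * d') := by
  ext x : 1
  simp only [mul_apply_eq_comp, block_apply, add_apply]
  congr 2
  · change a (_ + _) + b (_ + _) = _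
    rw [map_add, map_add]
    abel
  · change c (_ + _) + d (_ + _) = _
    rw [map_add, map_add]
    abel

theorem block_add (a b c d a' b' c' d' : H →L[ℂ] H) :
    block a b c d + block a' b' c' d' = block (a + a') (b + b') (c + c') (d + d') := by
  ext x : 1
  simp only [block_apply, add_apply, ← WithLp.toLp_add, Prod.mk_add_mk]
  congr 2 <;> abel

theorem block_sub (a b c d a' b' c' d' : H →L[ℂ] H) :
    block a b c d - block a' b' c' d' = block (a - a') (b - b') (c - c') (d - d') := by
  rw [sub_eq_iff_eq_add, block_add]
  simp

theorem norm_block_le (a b c d : H →L[ℂ] H) :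
    ‖block a b c d‖ ≤ ‖a‖ + ‖b‖ + ‖c‖ + ‖d‖ := by
  refine ContinuousLinearMap.opNorm_le_bound _ (by positivity) fun x => ?_
  have h1 : ‖x.fst‖ ≤ ‖x‖ := WithLp.norm_fst_le H x
  have h2 : ‖x.snd‖ ≤ ‖x‖ := WithLp.norm_snd_le H x
  have key : block a b c d x = WithLp.toLp 2 (a x.fst + b x.snd, 0) +
      WithLp.toLp 2 (0, c x.fst + d x.snd) := by
    rw [block_apply, ← WithLp.toLp_add]
    simp
  have bound (f : H →L[ℂ] H) {y : H} (hy : ‖y‖ ≤ ‖x‖) : ‖f y‖ ≤ ‖f‖ * ‖x‖ := f.le_opNorm_of_le hy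
  calc ‖block a b c d x‖ ≤ ‖a x.fst + b x.snd‖ + ‖c x.fst + d x.snd‖ := by
        rw [key]
        refine (norm_add_le _ _).trans (le_of_eq ?_)
        simp
    _ ≤ (‖a x.fst‖ + ‖b x.snd‖) + (‖c x.fst‖ + ‖d x.snd‖) :=
        add_le_add (norm_add_le _ _) (norm_add_le _ _)
    _ ≤ (‖a‖ * ‖x‖ + ‖b‖ * ‖x‖) + (‖c‖ * ‖x‖ + ‖d‖ * ‖x‖) := by
        gcongr <;> exact bound _ ‹_›
    _ = _ := by ring

variable [CompleteSpace H]

theorem adjoint_block (a b c d : H →L[ℂ] H) :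
    ContinuousLinearMap.adjoint (block a b c d) =
      block (ContinuousLinearMap.adjoint a) (ContinuousLinearMap.adjoint c)
        (ContinuousLinearMap.adjoint b) (ContinuousLinearMap.adjoint d) := by
  symm
  rw [ContinuousLinearMap.eq_adjoint_iff]
  intro x y
  simp only [block_apply, WithLp.prod_inner_apply, inner_add_left, inner_add_right,
    ContinuousLinearMap.adjoint_inner_left]
  change ⟪x.fst, _⟫_ℂ + ⟪x.snd, _⟫_ℂ + (⟪x.fst, _⟫_ℂ + ⟪x.snd, _⟫_ℂ) =
    ⟪x.fst, _⟫_ℂ + ⟪x.fst, _⟫_ℂ + (⟪x.snd, _⟫_ℂ + ⟪x.snd, _⟫_ℂ)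
  exact add_add_add_comm _ _ _ _

end Blocks

/-! ### Resolvents of 1 + T*T and 1 + TT*, through graphs. -/

section Resolvents

variable {H : Type*} [NormedAddCommGroup H] [InnerProductSpace ℂ H]

/-- Two linear relations are formally adjoint to each other. -/
def IsDualPair (G G' : Submodule ℂ (H × H)) : Prop :=
  ∀ p ∈ G, ∀ q ∈ G', ⟪q.2, p.1⟫_ℂ = ⟪q.1, p.2⟫_ℂ

/-- For `G` the graph of `T` and `G'` that of `T*`: `R` is a right inverse of `1 + T*T`
and `S = TR`. -/
def IsResolvent (G G' : Submodule ℂ (H × H)) (R S : H →L[ℂ] H) : Prop :=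
  ∀ y, (R y, S y) ∈ G ∧ (S y, y - R y) ∈ G'

variable {G G' : Submodule ℂ (H × H)} {R S : H →L[ℂ] H}

theorem IsDualPair.symm (h : IsDualPair G G') : IsDualPair G' G := fun p hp q hq => by
  rw [← inner_conj_symm, ← h q hq p hp, inner_conj_symm]

theorem IsResolvent.inner_eq (hR : IsResolvent G G' R S) (h : IsDualPair G G') (y z : H) :
    ⟪z, R y⟫_ℂ = ⟪S z, S y⟫_ℂ + ⟪R z, R y⟫_ℂ := by
  have := h _ (hR y).1 _ (hR z).2
  simp only [inner_sub_left] at this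
  rw [← this]
  ring

theorem IsResolvent.inner_symm (hR : IsResolvent G G' R S) (h : IsDualPair G G') (y z : H) :
    ⟪R z, y⟫_ℂ = ⟪z, R y⟫_ℂ := by
  rw [hR.inner_eq h, ← inner_conj_symm, hR.inner_eq h]
  simp

/-- Completing the square in ⟪y, Ry⟫ = ‖Sy‖² + ‖Ry‖². Both bounds by 1/2, on S and on R - 1/2, are
read off from it. -/
theorem IsResolvent.norm_sq_add (hR : IsResolvent G G' R S) (h : IsDualPair G G') (y : H) :
    ‖R y - (1 / 2 : ℂ) • y‖ ^ 2 + ‖S y‖ ^ 2 = (‖y‖ / 2) ^ 2 := by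
  have e := congrArg RCLike.re (hR.inner_eq h y y)
  rw [map_add, inner_self_eq_norm_sq, inner_self_eq_norm_sq] at e
  rw [@norm_sub_sq ℂ, inner_smul_right, norm_smul, hR.inner_symm h]
  have : RCLike.re ((1 / 2 : ℂ) * ⟪y, R y⟫_ℂ) = RCLike.re ⟪y, R y⟫_ℂ / 2 := by
    simp
    ring
  rw [this]
  simp only [norm_div, norm_one, Complex.norm_ofNat]
  rw [e]
  ring

theorem IsResolvent.norm_le_half (hR : IsResolvent G G' R S) (h : IsDualPair G G') :
    ‖S‖ ≤ 1 / 2 :=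
  S.opNorm_le_bound (by norm_num) fun y => by
    have := hR.norm_sq_add h y
    refine abs_le_of_sq_le_sq' (b := 1 / 2 * ‖y‖) ?_ (by positivity) |>.2
    nlinarith [sq_nonneg ‖R y - (1 / 2 : ℂ) • y‖]

theorem IsResolvent.norm_sub_half_le (hR : IsResolvent G G' R S) (h : IsDualPair G G') :
    ‖R - (1 / 2 : ℂ) • 1‖ ≤ 1 / 2 :=
  ContinuousLinearMap.opNorm_le_bound _ (by norm_num) fun y => by
    have := hR.norm_sq_add h y
    refine abs_le_of_sq_le_sq' (b := 1 / 2 * ‖y‖) ?_ (by positivity) |>.2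
    change ‖R y - (1 / 2 : ℂ) • y‖ ^ 2 ≤ _
    nlinarith [sq_nonneg ‖S y‖]

theorem IsResolvent.norm_le_one (hR : IsResolvent G G' R S) (h : IsDualPair G G') :
    ‖R‖ ≤ 1 := by
  have e : R = (R - (1 / 2 : ℂ) • 1) + (1 / 2 : ℂ) • 1 := by simp
  have h1 : ‖(1 / 2 : ℂ) • (1 : H →L[ℂ] H)‖ ≤ 1 / 2 := by
    rw [norm_smul]
    have : ‖(1 : H →L[ℂ] H)‖ ≤ 1 := ContinuousLinearMap.norm_id_le
    simp only [norm_div, norm_one, Complex.norm_ofNat]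
    linarith
  rw [e]
  exact (norm_add_le _ _).trans (by linarith [hR.norm_sub_half_le h])

variable [CompleteSpace H]

open ContinuousLinearMap (adjoint)

theorem IsResolvent.adjoint_eq (hR : IsResolvent G G' R S) (h : IsDualPair G G') :
    adjoint R = R := by
  symm
  rw [ContinuousLinearMap.eq_adjoint_iff]
  exact fun x y => hR.inner_symm h y x

theorem IsResolvent.adjoint_mul (hR : IsResolvent G G' R S) (h : IsDualPair G G') :
    adjoint S * S = R - R * R := by
  ext y
  refine ext_inner_left ℂ fun z => ?_
  simp only [mul_apply_eq_comp, sub_apply,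
    ContinuousLinearMap.adjoint_inner_right, inner_sub_right]
  rw [hR.inner_eq h y z, ← hR.inner_symm h (R y) z]
  ring

/-- If `R'` is a right inverse of `1 + TT*`, then `T* R' = (T R)*`. -/
theorem IsResolvent.dual (hR : IsResolvent G G' R S) (h : IsDualPair G G') {R' : H →L[ℂ] H}
    (hR' : ∀ y, ∃ w, (R' y, w) ∈ G' ∧ (w, y - R' y) ∈ G) :
    IsResolvent G' G R' (adjoint S) := by
  intro y
  obtain ⟨w, h1, h2⟩ := hR' y
  suffices adjoint S y = w by rw [this]; exact ⟨h1, h2⟩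
  refine ext_inner_right ℂ fun z => ?_
  rw [ContinuousLinearMap.adjoint_inner_left]
  -- In the sum of the two pairings the terms with `R` and `R'` cancel, leaving ⟪y, Sz⟫ = ⟪w, z⟫.
  have e1 := h _ (hR z).1 _ h1
  have e2 := h.symm _ (hR z).2 _ h2
  simp only [inner_sub_left, inner_sub_right] at e1 e2
  linear_combination -e1 + e2

/-- Formally (1 + TT*)⁻¹T = T(1 + T*T)⁻¹, applied after R. It turns the commutator of R and S into
(R - R')S. -/
theorem IsResolvent.mul_comm_dual (hR : IsResolvent G G' R S) (h : IsDualPair G G')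
    {R' : H →L[ℂ] H} (hR' : IsResolvent G' G R' (adjoint S)) : R' * S = S * R := by
  ext y
  refine ext_inner_left ℂ fun z => ?_
  simp only [mul_apply_eq_comp]
  rw [← hR'.inner_symm h.symm]
  exact (h _ (hR y).1 _ (hR' z).1).symm.trans (ContinuousLinearMap.adjoint_inner_left S _ _)

end Resolvents

/-! ### The bound ‖Q² - Q‖ ≤ 4ε. -/

section AlmostProjections

variable {H : Type*} [NormedAddCommGroup H] [InnerProductSpace ℂ H] [CompleteSpace H]
  {G G' : Submodule ℂ (H × H)} {R R' S X : H →L[ℂ] H} {ε : ℝ}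

open ContinuousLinearMap (adjoint)

/-- The self-adjoint block operator `(R, S; S*, 1 - R)`. -/
def blockQ (R S : H →L[ℂ] H) : WithLp 2 (H × H) →L[ℂ] WithLp 2 (H × H) :=
  block R S (adjoint S) (1 - R)

theorem norm_mul_le_of_le (a b : H →L[ℂ] H) {r s : ℝ} (ha : ‖a‖ ≤ r) (hb : ‖b‖ ≤ s) :
    ‖a * b‖ ≤ r * s :=
  (norm_mul_le a b).trans (mul_le_mul ha hb (norm_nonneg _) ((norm_nonneg _).trans ha))

theorem norm_blockQ_sq_sub_le (hR : adjoint R = R) :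
    ‖blockQ R S * blockQ R S - blockQ R S‖ ≤
      ‖S * adjoint S - (R - R * R)‖ + 2 * ‖R * S - S * R‖ + ‖adjoint S * S - (R - R * R)‖ := by
  have hc : ‖adjoint S * R - R * adjoint S‖ = ‖R * S - S * R‖ := by
    rw [← LinearIsometryEquiv.norm_map adjoint (R * S - S * R), map_sub]
    change _ = ‖adjoint (R ∘L S) - adjoint (S ∘L R)‖
    rw [ContinuousLinearMap.adjoint_comp, ContinuousLinearMap.adjoint_comp, hR]
    rfl
  rw [blockQ, block_mul, block_sub]
  refine (norm_block_le _ _ _ _).trans (le_of_eq ?_)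
  rw [show R * R + S * adjoint S - R = S * adjoint S - (R - R * R) by abel,
    show R * S + S * (1 - R) - S = R * S - S * R by noncomm_ring,
    show adjoint S * R + (1 - R) * adjoint S - adjoint S = adjoint S * R - R * adjoint S by
      noncomm_ring,
    show adjoint S * S + (1 - R) * (1 - R) - (1 - R) = adjoint S * S - (R - R * R) by
      noncomm_ring, hc]
  ring

/-- The hypothesis `hX` is the second resolvent identity for T*T = TT* + X; both resolvents are
contractions. -/
theorem norm_sub_le_of_perturb (h : IsDualPair G G') (hR : IsResolvent G G' R S)
    (hR' : IsResolvent G' G R' (adjoint S)) (hX : R' = R + R * X * R') (hXε : ‖X‖ ≤ ε) :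
    ‖R - R'‖ ≤ ε := by
  have : R - R' = -(R * X * R') := by
    nth_rewrite 1 [hX]
    abel
  rw [this, norm_neg]
  refine (norm_mul_le_of_le _ _ (norm_mul_le_of_le _ _ (hR.norm_le_one h) hXε)
    (hR'.norm_le_one h.symm)).trans (le_of_eq (by ring))

/-- The case `R = (1 + T*T)⁻¹`. -/
theorem norm_blockQ_sq_sub_le_of_isResolvent (h : IsDualPair G G') (hR : IsResolvent G G' R S)
    (hR' : IsResolvent G' G R' (adjoint S)) (hX : R' = R + R * X * R') (hXε : ‖X‖ ≤ ε) :
    ‖blockQ R S * blockQ R S - blockQ R S‖ ≤ 4 * ε := by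
  have hD := norm_sub_le_of_perturb h hR hR' hX hXε
  have e1 : S * adjoint S = R' - R' * R' := by
    simpa using hR'.adjoint_mul h.symm
  have e2 := hR.mul_comm_dual h hR'
  have h1 : ‖S * adjoint S - (R - R * R)‖ ≤ ε := by
    -- Centring both resolvents at 1/2 gives each factor norm at most 1/2, so the total is ε.
    have : S * adjoint S - (R - R * R) =
        (R - (1 / 2 : ℂ) • 1) * (R - R') + (R - R') * (R' - (1 / 2 : ℂ) • 1) := by
      rw [e1]
      simp only [sub_mul, mul_sub, smul_mul_assoc, mul_smul_comm, one_mul, mul_one]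
      module
    rw [this]
    refine (norm_add_le _ _).trans ?_
    have := norm_mul_le_of_le _ _ (hR.norm_sub_half_le h) hD
    have := norm_mul_le_of_le _ _ hD (hR'.norm_sub_half_le h.symm)
    linarith
  have h2 : ‖R * S - S * R‖ ≤ ε * (1 / 2) := by
    rw [← e2, ← sub_mul]
    exact norm_mul_le_of_le _ _ hD (hR.norm_le_half h)
  have h3 : ‖adjoint S * S - (R - R * R)‖ = 0 := by
    rw [hR.adjoint_mul h, sub_self, norm_zero]
  have := norm_blockQ_sq_sub_le (S := S) (hR.adjoint_eq h)
  have := (norm_nonneg X).trans hXε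
  linarith

/-- Here S + SXR' plays the role of TR'. Factor it as S(1 + XR') and use S*S = R - R² together with
R(1 + XR') = R'. -/
theorem adjoint_mul_self_of_perturb (h : IsDualPair G G') (hR : IsResolvent G G' R S)
    (hR' : IsResolvent G' G R' (adjoint S)) (hX : R' = R + R * X * R') :
    adjoint (S + S * X * R') * (S + S * X * R') = R' - R' * R' + R' * adjoint X * R' := by
  have e0 : adjoint (1 + X * R') = 1 + R' * adjoint X := by
    rw [map_add]
    change adjoint (ContinuousLinearMap.id ℂ H) + adjoint (X ∘L R') = _
    rw [ContinuousLinearMap.adjoint_comp, hR'.adjoint_eq h.symm, ContinuousLinearMap.adjoint_id]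
    rfl
  have e1 : R * (1 + X * R') = R' := by
    nth_rewrite 2 [hX]
    noncomm_ring
  have e2 : (1 + R' * adjoint X) * R = R' := by
    have := congrArg adjoint e1
    change adjoint (R ∘L (1 + X * R')) = _ at this
    rw [ContinuousLinearMap.adjoint_comp, hR'.adjoint_eq h.symm, hR.adjoint_eq h, e0] at this
    exact this
  have e3 : S + S * X * R' = S * (1 + X * R') := by noncomm_ring
  have e4 : adjoint (S * (1 + X * R')) = (1 + R' * adjoint X) * adjoint S := by
    rw [← e0]
    exact ContinuousLinearMap.adjoint_comp _ _
  calc adjoint (S + S * X * R') * (S + S * X * R')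
      = (1 + R' * adjoint X) * (adjoint S * S) * (1 + X * R') := by
        rw [e3, e4]
        simp only [mul_assoc]
    _ = (1 + R' * adjoint X) * (R * (1 + X * R')) -
          (1 + R' * adjoint X) * R * (R * (1 + X * R')) := by
        rw [hR.adjoint_mul h]
        noncomm_ring
    _ = _ := by
        rw [e1, e2]
        noncomm_ring

/-- The case `R' = (1 + TT*)⁻¹`, where `T R' = T R + T R X R'` with `R = (1 + T*T)⁻¹`. -/
theorem norm_blockQ_sq_sub_le_of_isResolvent_dual (h : IsDualPair G G')
    (hR : IsResolvent G G' R S) (hR' : IsResolvent G' G R' (adjoint S))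
    (hX : R' = R + R * X * R') (hXε : ‖X‖ ≤ ε) (hε : ε ≤ 1) :
    ‖blockQ R' (S + S * X * R') * blockQ R' (S + S * X * R') - blockQ R' (S + S * X * R')‖ ≤
      4 * ε := by
  have hε0 := (norm_nonneg X).trans hXε
  have hD := norm_sub_le_of_perturb h hR hR' hX hXε
  have hS := hR.norm_le_half h
  have hS' : ‖adjoint S‖ ≤ 1 / 2 := by rwa [LinearIsometryEquiv.norm_map]
  have hR1 := hR'.norm_le_one h.symm
  have e1 : S * adjoint S = R' - R' * R' := by
    simpa using hR'.adjoint_mul h.symm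
  have e2 := hR.mul_comm_dual h hR'
  have e3 := adjoint_mul_self_of_perturb h hR hR' hX
  have hE : ‖S * X * R'‖ ≤ ε / 2 :=
    (norm_mul_le_of_le _ _ (norm_mul_le_of_le _ _ hS hXε) hR1).trans (le_of_eq (by ring))
  generalize S * X * R' = E at hE e3 ⊢
  have hE' : ‖adjoint E‖ ≤ ε / 2 := by rwa [LinearIsometryEquiv.norm_map]
  have h1 : ‖(S + E) * adjoint (S + E) - (R' - R' * R')‖ ≤ ε / 2 + ε ^ 2 / 4 := by
    rw [← e1, map_add, show (S + E) * (adjoint S + adjoint E) - S * adjoint S =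
      S * adjoint E + E * adjoint S + E * adjoint E by noncomm_ring]
    have h1 := norm_mul_le_of_le _ _ hS hE'
    have h2 := norm_mul_le_of_le _ _ hE hS'
    have h3 := norm_mul_le_of_le _ _ hE hE'
    refine (norm_add₃_le ..).trans ?_
    nlinarith
  have h2 : ‖R' * (S + E) - (S + E) * R'‖ ≤ ε := by
    -- A commutator is unchanged when `R'` is shifted by a scalar, so the terms with `E` cost only
    -- ‖R' - 1/2‖ ≤ 1/2.
    have : R' * (S + E) - (S + E) * R' = S * (R - R') +
        (R' - (1 / 2 : ℂ) • 1) * E - E * (R' - (1 / 2 : ℂ) • 1) := by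
      rw [mul_add, e2]
      simp only [sub_mul, mul_sub, add_mul, smul_mul_assoc, mul_smul_comm, one_mul, mul_one]
      module
    rw [this]
    have hh := hR'.norm_sub_half_le h.symm
    have h1 := norm_mul_le_of_le _ _ hS hD
    have h2 := norm_mul_le_of_le _ _ hh hE
    have h3 := norm_mul_le_of_le _ _ hE hh
    refine (norm_sub_le _ _).trans ((add_le_add_left (norm_add_le _ _) _).trans ?_)
    linarith
  have h3 : ‖adjoint (S + E) * (S + E) - (R' - R' * R')‖ ≤ ε := by
    rw [e3, add_sub_cancel_left]
    have hX' : ‖adjoint X‖ ≤ ε := by rwa [LinearIsometryEquiv.norm_map]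
    exact (norm_mul_le_of_le _ _ (norm_mul_le_of_le _ _ hR1 hX') hR1).trans (le_of_eq (by ring))
  have := norm_blockQ_sq_sub_le (S := S + E) (hR'.adjoint_eq h.symm)
  -- The entries add up to 7ε/2 + ε²/4, which is at most 4ε because ε ≤ 1.
  nlinarith

end AlmostProjections

/-! ### Finite-dimensional approximation of compact operators, and bases. -/

section CompactOperators

open Filter Topology ContinuousLinearMap

section General

variable {E : Type*} [NormedAddCommGroup E] [InnerProductSpace ℂ E]
  {U : ℕ → Submodule ℂ E} [∀ n, (U n).HasOrthogonalProjection]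

/-- Strong convergence of projections to the identity is uniform on the image of the unit ball
under a compact operator. -/
theorem tendsto_starProjection_mul (hU : Monotone U) (hU' : ⊤ ≤ (⨆ n, U n).topologicalClosure)
    {K : E →L[ℂ] E} (hK : IsCompactOperator K) :
    Tendsto (fun n => (U n).starProjection * K) atTop (𝓝 K) := by
  rw [Metric.tendsto_atTop]
  intro η hη
  obtain ⟨s, hs, hKs⟩ := hK.image_closedBall_subset_compact (f := (K : E →ₗ[ℂ] E)) 1
  -- A finite η/4-net of the image of the unit ball: pointwise convergence on the net suffices, and
  -- the three error terms sum to 3η/4.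
  obtain ⟨t, htf, hst⟩ := Metric.totallyBounded_iff.1 hs.totallyBounded (η / 4) (by positivity)
  have hev : ∀ᶠ n in atTop, ∀ y ∈ t, ‖(U n).starProjection y - y‖ < η / 4 := by
    rw [eventually_all_finite htf]
    intro y _
    have := Submodule.starProjection_tendsto_self U hU y hU'
    simpa [dist_eq_norm] using (Metric.tendsto_nhds.1 this) (η / 4) (by positivity)
  obtain ⟨N, hN⟩ := eventually_atTop.1 hev
  refine ⟨N, fun n hn => ?_⟩
  rw [dist_eq_norm]
  refine lt_of_le_of_lt (b := 3 * η / 4) ?_ (by linarith)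
  refine ContinuousLinearMap.opNorm_le_of_unit_norm (by positivity) fun x hx => ?_
  have hx' : K x ∈ s := hKs ⟨x, by simp [hx], rfl⟩
  obtain ⟨y, hy, hxy⟩ := Set.mem_iUnion₂.1 (hst hx')
  have hxy' : ‖K x - y‖ < η / 4 := by simpa [dist_eq_norm] using hxy
  have h1 := hN n hn y hy
  have h2 := (U n).norm_starProjection_apply_le (K x - y)
  have e : ((U n).starProjection * K - K) x = (U n).starProjection (K x - y) +
      ((U n).starProjection y - y) - (K x - y) := by
    rw [map_sub]
    change (U n).starProjection (K x) - K x = _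
    abel
  rw [e]
  refine (norm_sub_le _ _).trans ((add_le_add_left (norm_add_le _ _) _).trans ?_)
  linarith

theorem adjoint_starProjection [CompleteSpace E] (V : Submodule ℂ E) [V.HasOrthogonalProjection] :
    adjoint V.starProjection = V.starProjection := by
  symm
  rw [eq_adjoint_iff]
  exact V.inner_starProjection_left_eq_right

theorem tendsto_mul_starProjection_of_adjoint [CompleteSpace E] {T : E →L[ℂ] E}
    (h : Tendsto (fun n => (U n).starProjection * adjoint T) atTop (𝓝 (adjoint T))) :
    Tendsto (fun n => T * (U n).starProjection) atTop (𝓝 T) := by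
  have := ((adjoint (𝕜 := ℂ) (E := E) (F := E)).continuous.tendsto _).comp h
  rw [adjoint_adjoint] at this
  refine this.congr fun n => ?_
  change adjoint ((U n).starProjection ∘L adjoint T) = _
  rw [adjoint_comp, adjoint_adjoint, adjoint_starProjection]
  rfl

theorem tendsto_compression [CompleteSpace E] (hU : Monotone U)
    (hU' : ⊤ ≤ (⨆ n, U n).topologicalClosure) {K : E →L[ℂ] E} (hK : IsCompactOperator K)
    (hK' : adjoint K = K) :
    Tendsto (fun n => (U n).starProjection * K * (U n).starProjection) atTop (𝓝 K) := by
  have h1 := tendsto_starProjection_mul hU hU' hK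
  have h2 := tendsto_mul_starProjection_of_adjoint (U := U) (T := K) (by rwa [hK'])
  rw [tendsto_iff_norm_sub_tendsto_zero] at h1 h2 ⊢
  refine squeeze_zero (fun _ => norm_nonneg _) (fun n => ?_) (by simpa using h1.add h2)
  have e : (U n).starProjection * K * (U n).starProjection - K =
      ((U n).starProjection * K - K) * (U n).starProjection + (K * (U n).starProjection - K) := by
    noncomm_ring
  rw [e]
  refine (norm_add_le _ _).trans (add_le_add_left ?_ _)
  refine (norm_mul_le _ _).trans ?_
  exact mul_le_of_le_one_right (norm_nonneg _) (U n).starProjection_norm_le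

theorem isCompactOperator_of_tendsto_mul_starProjection [CompleteSpace E]
    [∀ n, FiniteDimensional ℂ (U n)] {T : E →L[ℂ] E}
    (h : Tendsto (fun n => T * (U n).starProjection) atTop (𝓝 T)) : IsCompactOperator T := by
  refine isCompactOperator_of_tendsto h (Eventually.of_forall fun n => ?_)
  have := FiniteDimensional.proper ℂ (U n)
  exact ((isCompactOperator_id (E := U n)).clm_comp (T ∘L (U n).subtypeL)).comp_clm
    (U n).orthogonalProjectionOnto

/-- By the C*-identity, ‖TP - T‖² = ‖(P - 1)T*T(P - 1)‖ ≤ 2‖PT*T - T*T‖. This makes T a norm limit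
of finite-rank operators once T*T is compact. -/
theorem tendsto_mul_starProjection_of_adjoint_mul [CompleteSpace E] (hU : Monotone U)
    (hU' : ⊤ ≤ (⨆ n, U n).topologicalClosure) {T : E →L[ℂ] E}
    (hT : IsCompactOperator (adjoint T * T)) :
    Tendsto (fun n => T * (U n).starProjection) atTop (𝓝 T) := by
  have h1 := tendsto_starProjection_mul hU hU' hT
  rw [tendsto_iff_norm_sub_tendsto_zero] at h1 ⊢
  have h2 : Tendsto (fun n => √(2 * ‖(U n).starProjection * (adjoint T * T) - adjoint T * T‖))
      atTop (𝓝 0) := by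
    simpa using (h1.const_mul 2).sqrt
  refine squeeze_zero (fun _ => norm_nonneg _) (fun n => ?_) h2
  refine Real.le_sqrt_of_sq_le ?_
  set P := (U n).starProjection
  have hP : adjoint P = P := adjoint_starProjection _
  have e : adjoint (T * P - T) ∘L (T * P - T) =
      (P * (adjoint T * T) - adjoint T * T) * (P - 1) := by
    rw [map_sub]
    change (adjoint (T ∘L P) - adjoint T) * (T * P - T) = _
    rw [adjoint_comp, hP]
    change (P * adjoint T - adjoint T) * (T * P - T) = _
    noncomm_ring
  have h3 : ‖P - 1‖ ≤ 2 := by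
    refine (norm_sub_le _ _).trans ?_
    have h1 : ‖(1 : E →L[ℂ] E)‖ ≤ 1 := ContinuousLinearMap.norm_id_le
    have h2 : ‖P‖ ≤ 1 := (U n).starProjection_norm_le
    linarith
  rw [sq, ← norm_adjoint_comp_self, e, mul_comm 2]
  exact (norm_mul_le _ _).trans (mul_le_mul_of_nonneg_left h3 (norm_nonneg _))

end General

section Double

variable {H : Type*} [NormedAddCommGroup H] [InnerProductSpace ℂ H]

/-- `L ⊕ L` inside `H ⊕ H`. -/
def double (L : Submodule ℂ H) : Submodule ℂ (WithLp 2 (H × H)) :=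
  (L.prod L).map (WithLp.linearEquiv 2 ℂ (H × H)).symm.toLinearMap

theorem mem_double {L : Submodule ℂ H} {x : WithLp 2 (H × H)} :
    x ∈ double L ↔ x.fst ∈ L ∧ x.snd ∈ L := by
  constructor
  · rintro ⟨y, hy, rfl⟩
    exact hy
  · intro h
    exact ⟨(x.fst, x.snd), h, rfl⟩

theorem finrank_double (L : Submodule ℂ H) [FiniteDimensional ℂ L] :
    Module.finrank ℂ (double L) = 2 * Module.finrank ℂ L := by
  let f : double L ≃ₗ[ℂ] L × L :=
    { toFun := fun x => (⟨x.1.fst, (mem_double.1 x.2).1⟩, ⟨x.1.snd, (mem_double.1 x.2).2⟩)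
      map_add' := fun _ _ => rfl
      map_smul' := fun _ _ => rfl
      invFun := fun y => ⟨WithLp.toLp 2 (y.1, y.2), mem_double.2 ⟨y.1.2, y.2.2⟩⟩
      left_inv := fun _ => rfl
      right_inv := fun _ => rfl }
  rw [f.finrank_eq, Module.finrank_prod, two_mul]

instance (L : Submodule ℂ H) [FiniteDimensional ℂ L] : FiniteDimensional ℂ (double L) := by
  have h : L.FG := Module.Finite.iff_fg.1 ‹_›
  exact Module.Finite.iff_fg.2 ((h.prod h).map _)

end Double

section Bases

variable {H : Type*} [NormedAddCommGroup H] [InnerProductSpace ℂ H]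

instance (e : HilbertBasis ℕ ℂ H) (N : ℕ) : FiniteDimensional ℂ (firstSpan e N) :=
  Module.Finite.iff_fg.2 (Submodule.fg_span ((Set.finite_Iio N).image _))

theorem finrank_firstSpan (e : HilbertBasis ℕ ℂ H) (N : ℕ) :
    Module.finrank ℂ (firstSpan e N) = N := by
  have : e '' Set.Iio N = Set.range fun i : Fin N => e i := by
    ext x
    simp only [Set.mem_image, Set.mem_Iio, Set.mem_range]
    exact ⟨fun ⟨i, hi, h⟩ => ⟨⟨i, hi⟩, h⟩, fun ⟨i, h⟩ => ⟨i, i.2, h⟩⟩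
  rw [firstSpan, this, finrank_span_eq_card, Fintype.card_fin]
  exact e.orthonormal.linearIndependent.comp _ Fin.val_injective

theorem firstSpan_mono (e : HilbertBasis ℕ ℂ H) : Monotone (firstSpan e) := fun _ _ h =>
  Submodule.span_mono (Set.image_mono (Set.Iio_subset_Iio h))

theorem firstSpan_dense (e : HilbertBasis ℕ ℂ H) :
    ⊤ ≤ (⨆ n, firstSpan e n).topologicalClosure := by
  rw [← e.dense_span]
  refine Submodule.topologicalClosure_mono (Submodule.span_le.2 ?_)
  rintro _ ⟨i, rfl⟩
  exact Submodule.mem_iSup_of_mem (i + 1)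
    (Submodule.subset_span (Set.mem_image_of_mem _ (Nat.lt_succ_self i)))

theorem doubleSpan_mono (e : HilbertBasis ℕ ℂ H) : Monotone (doubleSpan e) := fun _ _ h _ hx =>
  mem_double.2 ⟨firstSpan_mono e h (mem_double.1 hx).1, firstSpan_mono e h (mem_double.1 hx).2⟩

theorem doubleSpan_dense (e : HilbertBasis ℕ ℂ H) :
    ⊤ ≤ (⨆ n, doubleSpan e n).topologicalClosure := by
  intro x _
  have h (y : H) := Submodule.starProjection_tendsto_self _ (firstSpan_mono e) y (firstSpan_dense e)
  have hx := (((WithLp.prod_continuous_toLp 2 H H).tendsto _).comp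
    ((h x.fst).prodMk_nhds (h x.snd)))
  refine mem_closure_of_tendsto hx (Eventually.of_forall fun n => ?_)
  refine Submodule.mem_iSup_of_mem n (mem_double.2 ⟨?_, ?_⟩)
  · exact Submodule.starProjection_apply_mem _ _
  · exact Submodule.starProjection_apply_mem _ _

theorem isCompactOperator_block {a b c d : H →L[ℂ] H} (ha : IsCompactOperator a)
    (hb : IsCompactOperator b) (hc : IsCompactOperator c) (hd : IsCompactOperator d) :
    IsCompactOperator (block a b c d) := by
  have key : ⇑(block a b c d) =
      ⇑(WithLp.prodContinuousLinearEquiv 2 ℂ H H).symm.toContinuousLinearMap ∘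
      (⇑(ContinuousLinearMap.inl ℂ H H) ∘
          (⇑a ∘ ⇑(WithLp.fstL 2 ℂ H H) + ⇑b ∘ ⇑(WithLp.sndL 2 ℂ H H)) +
        ⇑(ContinuousLinearMap.inr ℂ H H) ∘
          (⇑c ∘ ⇑(WithLp.fstL 2 ℂ H H) + ⇑d ∘ ⇑(WithLp.sndL 2 ℂ H H))) := by
    ext x : 1
    rw [block_apply]
    simp
  have h := (((ha.comp_clm (WithLp.fstL 2 ℂ H H)).add (hb.comp_clm (WithLp.sndL 2 ℂ H H))).clm_comp
    (ContinuousLinearMap.inl ℂ H H)).add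
      (((hc.comp_clm (WithLp.fstL 2 ℂ H H)).add (hd.comp_clm (WithLp.sndL 2 ℂ H H))).clm_comp
        (ContinuousLinearMap.inr ℂ H H))
  rw [key]
  exact h.clm_comp (WithLp.prodContinuousLinearEquiv 2 ℂ H H).symm.toContinuousLinearMap

variable [CompleteSpace H]

theorem exists_hilbertBasis_nat [TopologicalSpace.SeparableSpace H]
    (hH : ¬ FiniteDimensional ℂ H) : Nonempty (HilbertBasis ℕ ℂ H) := by
  obtain ⟨w, b, hb⟩ := exists_hilbertBasis ℂ H
  have ho := b.orthonormal
  have hc : Countable w := by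
    -- Orthonormal vectors are √2 apart, so these balls are disjoint and separability allows only
    -- countably many.
    have hd : Pairwise (Function.onFun Disjoint fun i : w => Metric.ball (b i) (1 / 2)) := by
      intro i j hij
      refine Metric.ball_disjoint_ball ?_
      have h2 : ‖b i - b j‖ ^ 2 = 2 := by
        rw [@norm_sub_sq ℂ, ho.2 hij, ho.1, ho.1]
        norm_num
      rw [dist_eq_norm]
      nlinarith [norm_nonneg (b i - b j)]
    exact hd.countable_of_isOpen_disjoint (fun _ => Metric.isOpen_ball)
      fun i => ⟨b i, Metric.mem_ball_self (by norm_num)⟩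
  have hi : Infinite w := by
    by_contra hfin
    rw [not_infinite_iff_finite] at hfin
    have := Fintype.ofFinite w
    exact hH b.toOrthonormalBasis.toBasis.finiteDimensional_of_finite
  obtain ⟨f⟩ := nonempty_equiv_of_countable (α := ℕ) (β := w)
  refine ⟨HilbertBasis.mk (ho.comp f f.injective) ?_⟩
  rw [f.surjective.range_comp, b.dense_span]

theorem isCompactOperator_of_adjoint_mul (e : HilbertBasis ℕ ℂ H) {T : H →L[ℂ] H}
    (hT : IsCompactOperator (adjoint T * T)) : IsCompactOperator T :=
  isCompactOperator_of_tendsto_mul_starProjection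
    (tendsto_mul_starProjection_of_adjoint_mul (firstSpan_mono e) (firstSpan_dense e) hT)

theorem isCompactOperator_adjoint (e : HilbertBasis ℕ ℂ H) {T : H →L[ℂ] H}
    (hT : IsCompactOperator T) : IsCompactOperator (adjoint T) :=
  isCompactOperator_of_tendsto_mul_starProjection (U := firstSpan e)
    (tendsto_mul_starProjection_of_adjoint (by
      rw [adjoint_adjoint]
      exact tendsto_starProjection_mul (firstSpan_mono e) (firstSpan_dense e) hT))

end Bases

end CompactOperators

/-! ### The spectral gap at 1/2 in finite dimension. -/

section SpectralSplitting

variable {V : Type*} [NormedAddCommGroup V] [InnerProductSpace ℂ V] [FiniteDimensional ℂ V]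

/-- The part of the spectrum above `1/2` of a symmetric `T` with `T² - T` small, and the rest. -/
theorem exists_spectral_splitting (T : V →L[ℂ] V) (hT : T.toLinearMap.IsSymmetric) {δ : ℝ}
    (hδ : 0 ≤ δ) (h : ‖T ∘L T - T‖ ≤ 1 / 4 - δ ^ 2) :
    ∃ W W' : Submodule ℂ V, Module.finrank ℂ W = countAboveHalf T.toLinearMap ∧
      Module.finrank ℂ W + Module.finrank ℂ W' = Module.finrank ℂ V ∧
      (∀ x ∈ W, (1 / 2 + δ) * ‖x‖ ^ 2 ≤ RCLike.re ⟪T x, x⟫_ℂ) ∧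
      ∀ x ∈ W', RCLike.re ⟪T x, x⟫_ℂ ≤ 1 / 2 * ‖x‖ ^ 2 := by
  set b := hT.eigenvectorBasis rfl with hb
  set l := hT.eigenvalues rfl with hl
  have hTb (i) : T (b i) = (l i : ℂ) • b i := hT.apply_eigenvectorBasis rfl i
  have hform (x : V) : RCLike.re ⟪T x, x⟫_ℂ = ∑ i, l i * ‖⟪b i, x⟫_ℂ‖ ^ 2 := by
    rw [← b.sum_inner_mul_inner (T x) x, map_sum]
    refine Finset.sum_congr rfl fun i _ => ?_
    have : ⟪T x, b i⟫_ℂ = l i * ⟪x, b i⟫_ℂ := by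
      rw [← inner_smul_right, ← hTb]
      exact hT x (b i)
    have h2 : RCLike.re ((l i : ℂ) * (⟪x, b i⟫_ℂ * ⟪b i, x⟫_ℂ)) =
        l i * RCLike.re (⟪x, b i⟫_ℂ * ⟪b i, x⟫_ℂ) := Complex.re_ofReal_mul _ _
    rw [this, mul_assoc, h2, inner_mul_symm_re_eq_norm, norm_mul, norm_inner_symm x, sq]
  have hnorm (x : V) : ‖x‖ ^ 2 = ∑ i, ‖⟪b i, x⟫_ℂ‖ ^ 2 := (b.sum_sq_norm_inner_right x).symm
  -- An eigenvalue l satisfies l² - l ≥ δ² - 1/4, that is (l - 1/2)² ≥ δ².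
  have hgap (i) (hi : 1 / 2 < l i) : 1 / 2 + δ ≤ l i := by
    have h1 : ‖(T ∘L T - T) (b i)‖ ≤ 1 / 4 - δ ^ 2 := by
      refine ((T ∘L T - T).le_opNorm (b i)).trans ?_
      rwa [b.norm_eq_one, mul_one]
    have h2 : (T ∘L T - T) (b i) = ((l i ^ 2 - l i : ℝ) : ℂ) • b i := by
      change T (T (b i)) - T (b i) = _
      rw [hTb, map_smul, hTb, smul_smul, ← sub_smul]
      push_cast
      ring_nf
    rw [h2, norm_smul, b.norm_eq_one, mul_one, Complex.norm_real, Real.norm_eq_abs] at h1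
    have h3 := (abs_le.1 h1).1
    by_contra! hlt
    nlinarith
  set W : Submodule ℂ V := ⨆ μ ∈ Set.Ioi (1 / 2 : ℝ), Module.End.eigenspace T.toLinearMap (μ : ℂ)
    with hW
  refine ⟨W, Wᗮ, rfl, W.finrank_add_finrank_orthogonal, fun x hx => ?_, fun x hx => ?_⟩
  · have hx0 (i) (hi : l i ≤ 1 / 2) : ⟪b i, x⟫_ℂ = 0 := by
      suffices W ≤ (ℂ ∙ b i)ᗮ from Submodule.mem_orthogonal_singleton_iff_inner_right.1 (this hx)
      refine iSup₂_le fun μ hμ y hy => Submodule.mem_orthogonal_singleton_iff_inner_right.2 ?_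
      have hy' : T y = (μ : ℂ) • y := Module.End.mem_eigenspace_iff.1 hy
      have e : ⟪T (b i), y⟫_ℂ = ⟪b i, T y⟫_ℂ := hT (b i) y
      rw [hTb, hy', inner_smul_left, inner_smul_right, Complex.conj_ofReal] at e
      have hne : ((l i : ℂ) - μ) ≠ 0 := by
        rw [sub_ne_zero]
        exact_mod_cast (hi.trans_lt hμ).ne
      have hmul : ((l i : ℂ) - μ) * ⟪b i, y⟫_ℂ = 0 := by linear_combination e
      exact (mul_eq_zero.1 hmul).resolve_left hne
    rw [hform, hnorm, Finset.mul_sum]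
    refine Finset.sum_le_sum fun i _ => ?_
    rcases le_or_gt (l i) (1 / 2) with hi | hi
    · simp [hx0 i hi]
    · exact mul_le_mul_of_nonneg_right (hgap i hi) (by positivity)
  · have hx0 (i) (hi : 1 / 2 < l i) : ⟪b i, x⟫_ℂ = 0 := by
      refine (Submodule.mem_orthogonal _ _).1 hx _ ?_
      exact Submodule.mem_iSup_of_mem (l i) (Submodule.mem_iSup_of_mem hi
        (Module.End.mem_eigenspace_iff.2 (hTb i)))
    rw [hform, hnorm, Finset.mul_sum]
    refine Finset.sum_le_sum fun i _ => ?_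
    rcases le_or_gt (l i) (1 / 2) with hi | hi
    · exact mul_le_mul_of_nonneg_right hi (by positivity)
    · simp [hx0 i hi]

end SpectralSplitting

/-! ### Comparison of quadratic forms and the dimension count. -/

section Index

variable {H : Type*} [NormedAddCommGroup H] [InnerProductSpace ℂ H]

/-- The projection of `H ⊕ H` onto the second summand. -/
def sndProj : WithLp 2 (H × H) →L[ℂ] WithLp 2 (H × H) := block 0 0 0 1

theorem sndProj_apply (x : WithLp 2 (H × H)) :
    sndProj x = WithLp.toLp 2 ((0 : H), x.snd) := by
  rw [sndProj, block_apply]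
  simp

theorem inner_sndProj (x y : WithLp 2 (H × H)) : ⟪sndProj x, y⟫_ℂ = ⟪x.snd, y.snd⟫_ℂ := by
  rw [sndProj_apply, WithLp.prod_inner_apply]
  simp

theorem inner_sndProj_right (x y : WithLp 2 (H × H)) : ⟪x, sndProj y⟫_ℂ = ⟪x.snd, y.snd⟫_ℂ := by
  rw [sndProj_apply, WithLp.prod_inner_apply]
  simp

theorem sndProj_mem_double {L : Submodule ℂ H} {x : WithLp 2 (H × H)} (hx : x ∈ double L) :
    sndProj x ∈ double L := by
  rw [sndProj_apply]
  exact mem_double.2 ⟨L.zero_mem, (mem_double.1 hx).2⟩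

theorem double_orthogonal_le (L : Submodule ℂ H) : double Lᗮ ≤ (double L)ᗮ := by
  intro x hx
  rw [Submodule.mem_orthogonal]
  intro y hy
  rw [mem_double] at hx hy
  rw [WithLp.prod_inner_apply]
  have h1 := (Submodule.mem_orthogonal _ _).1 hx.1 _ hy.1
  have h2 := (Submodule.mem_orthogonal _ _).1 hx.2 _ hy.2
  exact (congrArg₂ (· + ·) h1 h2).trans (add_zero 0)

theorem sndProj_mem_orthogonal {L : Submodule ℂ H} {x : WithLp 2 (H × H)}
    (hx : x ∈ (double L)ᗮ) : sndProj x ∈ (double L)ᗮ := by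
  rw [Submodule.mem_orthogonal] at hx ⊢
  intro y hy
  rw [inner_sndProj_right, ← inner_sndProj]
  exact hx _ (sndProj_mem_double hy)

variable {K : WithLp 2 (H × H) →L[ℂ] WithLp 2 (H × H)} {η δ : ℝ}

/-- The form of `sndProj` splits along L ⊕ L and its complement, while `K` is within η of an
operator that sees only `v`. -/
theorem abs_re_inner_sub_le (L : Submodule ℂ H) [FiniteDimensional ℂ L]
    (hK : ‖K - (double L).starProjection * K * (double L).starProjection‖ ≤ η)
    {v n : WithLp 2 (H × H)} (hv : v ∈ double L) (hn : n ∈ double Lᗮ) :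
    |RCLike.re ⟪(sndProj (H := H) + K) (v + n), v + n⟫_ℂ -
      (RCLike.re ⟪(sndProj (H := H) + K) v, v⟫_ℂ + ‖n.snd‖ ^ 2)| ≤ η * ‖v + n‖ ^ 2 := by
  set P := (double L).starProjection
  have hP : P (v + n) = v := by
    rw [map_add, Submodule.starProjection_eq_self_iff.2 hv,
      (Submodule.starProjection_apply_eq_zero_iff _).2 (double_orthogonal_le L hn), add_zero]
  have h1 : ⟪(P * K * P) (v + n), v + n⟫_ℂ = ⟪K v, v⟫_ℂ := by
    change ⟪P (K (P (v + n))), v + n⟫_ℂ = _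
    rw [Submodule.inner_starProjection_left_eq_right, hP]
  have h2 : ⟪sndProj (v + n), v + n⟫_ℂ = ⟪sndProj v, v⟫_ℂ + ⟪n.snd, n.snd⟫_ℂ := by
    have h3 : ⟪v.snd, n.snd⟫_ℂ = 0 :=
      (Submodule.mem_orthogonal _ _).1 (mem_double.1 hn).2 _ (mem_double.1 hv).2
    have h4 : ⟪n.snd, v.snd⟫_ℂ = 0 := inner_eq_zero_symm.1 h3
    rw [inner_sndProj, inner_sndProj]
    change ⟪v.snd + n.snd, v.snd + n.snd⟫_ℂ = _
    rw [inner_add_left, inner_add_right, inner_add_right, h3, h4]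
    ring
  have key : RCLike.re ⟪(sndProj (H := H) + K) (v + n), v + n⟫_ℂ -
      (RCLike.re ⟪(sndProj (H := H) + K) v, v⟫_ℂ + ‖n.snd‖ ^ 2) =
        RCLike.re ⟪(K - P * K * P) (v + n), v + n⟫_ℂ := by
    rw [sub_apply, inner_sub_left, h1, add_apply, add_apply, inner_add_left, inner_add_left, h2,
      ← inner_self_eq_norm_sq (𝕜 := ℂ) n.snd]
    simp only [map_add, map_sub]
    ring
  rw [key]
  refine (RCLike.abs_re_le_norm _).trans ((norm_inner_le_norm _ _).trans ?_)
  rw [sq, ← mul_assoc]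
  exact mul_le_mul_of_nonneg_right (ContinuousLinearMap.le_of_opNorm_le _ hK _) (norm_nonneg _)

theorem norm_add_sq_of_double {L : Submodule ℂ H} {v n : WithLp 2 (H × H)} (hv : v ∈ double L)
    (hn : n ∈ double Lᗮ) : ‖v + n‖ ^ 2 = ‖v‖ ^ 2 + ‖n‖ ^ 2 := by
  have := (Submodule.mem_orthogonal _ _).1 (double_orthogonal_le L hn) _ hv
  rw [@norm_add_sq ℂ, this]
  simp

theorem disjoint_double_orthogonal (L : Submodule ℂ H) {V N : Submodule ℂ (WithLp 2 (H × H))}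
    (hV : V ≤ double L) (hN : N ≤ double Lᗮ) : Disjoint V N :=
  (Submodule.isOrtho_iff_le.2 (hN.trans (double_orthogonal_le L)) |>.mono_right hV).disjoint.symm

/-- A subspace on which `sndProj + K` is above `1/2` with a gap and one on which it is below `1/2`
cannot be too large together, if both live where `K` is almost supported. -/
theorem finrank_add_finrank_le (hηδ : 2 * η < δ) (hδ : δ ≤ 1 / 2) {L L' : Submodule ℂ H}
    [FiniteDimensional ℂ L] [FiniteDimensional ℂ L']
    (hL : ‖K - (double L).starProjection * K * (double L).starProjection‖ ≤ η)
    (hL' : ‖K - (double L').starProjection * K * (double L').starProjection‖ ≤ η)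
    {V W : Submodule ℂ (WithLp 2 (H × H))} (hV : V ≤ double L) (hW : W ≤ double L')
    (hVK : ∀ x ∈ V, (1 / 2 + δ) * ‖x‖ ^ 2 ≤ RCLike.re ⟪(sndProj (H := H) + K) x, x⟫_ℂ)
    (hWK : ∀ x ∈ W, RCLike.re ⟪(sndProj (H := H) + K) x, x⟫_ℂ ≤ 1 / 2 * ‖x‖ ^ 2) :
    Module.finrank ℂ V + Module.finrank ℂ W ≤ Module.finrank ℂ L + Module.finrank ℂ L' := by
  let M := L ⊔ L'
  let inl : H →ₗ[ℂ] WithLp 2 (H × H) :=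
    (WithLp.linearEquiv 2 ℂ (H × H)).symm.toLinearMap ∘ₗ LinearMap.inl ℂ H H
  let inr : H →ₗ[ℂ] WithLp 2 (H × H) :=
    (WithLp.linearEquiv 2 ℂ (H × H)).symm.toLinearMap ∘ₗ LinearMap.inr ℂ H H
  have hinl : Function.Injective inl :=
    (WithLp.linearEquiv 2 ℂ (H × H)).symm.injective.comp LinearMap.inl_injective
  have hinr : Function.Injective inr :=
    (WithLp.linearEquiv 2 ℂ (H × H)).symm.injective.comp LinearMap.inr_injective
  -- Inside M ⊕ M, `V` is enlarged by vectors on which `sndProj` is the identity, and `W` by vectors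
  -- which it kills.
  let N := (Lᗮ ⊓ M).map inr
  let N' := (L'ᗮ ⊓ M).map inl
  have hfN : Module.finrank ℂ L + Module.finrank ℂ N = Module.finrank ℂ M := by
    rw [← (Submodule.equivMapOfInjective _ hinr _).finrank_eq]
    exact Submodule.finrank_add_inf_finrank_orthogonal le_sup_left
  have hfN' : Module.finrank ℂ L' + Module.finrank ℂ N' = Module.finrank ℂ M := by
    rw [← (Submodule.equivMapOfInjective _ hinl _).finrank_eq]
    exact Submodule.finrank_add_inf_finrank_orthogonal le_sup_right
  have hN : N ≤ double Lᗮ := by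
    rintro _ ⟨y, hy, rfl⟩
    exact mem_double.2 ⟨Submodule.zero_mem _, hy.1⟩
  have hN' : N' ≤ double L'ᗮ := by
    rintro _ ⟨y, hy, rfl⟩
    exact mem_double.2 ⟨hy.1, Submodule.zero_mem _⟩
  have hNM : N ≤ double M := by
    rintro _ ⟨y, hy, rfl⟩
    exact mem_double.2 ⟨Submodule.zero_mem _, hy.2⟩
  have hNM' : N' ≤ double M := by
    rintro _ ⟨y, hy, rfl⟩
    exact mem_double.2 ⟨hy.2, Submodule.zero_mem _⟩
  have hVM : V ≤ double M := fun x hx =>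
    mem_double.2 ((mem_double.1 (hV hx)).imp (fun h => le_sup_left (b := L') h)
      (fun h => le_sup_left (b := L') h))
  have hWM : W ≤ double M := fun x hx =>
    mem_double.2 ((mem_double.1 (hW hx)).imp (fun h => le_sup_right (a := L) h)
      (fun h => le_sup_right (a := L) h))
  have : FiniteDimensional ℂ V := Submodule.finiteDimensional_of_le hV
  have : FiniteDimensional ℂ W := Submodule.finiteDimensional_of_le hW
  have hdisj : Disjoint (V ⊔ N) (W ⊔ N') := by
    rw [Submodule.disjoint_def]
    intro x hx hx'
    obtain ⟨v, hv, n, hn, rfl⟩ := Submodule.mem_sup.1 hx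
    obtain ⟨w, hw, n', hn', e⟩ := Submodule.mem_sup.1 hx'
    have h1 := (abs_le.1 (abs_re_inner_sub_le L hL (hV hv) (hN hn))).1
    have h2 := (abs_le.1 (abs_re_inner_sub_le L' hL' (hW hw) (hN' hn'))).2
    have h3 := norm_add_sq_of_double (hV hv) (hN hn)
    have h4 := norm_add_sq_of_double (hW hw) (hN' hn')
    have h5 : ‖n.snd‖ = ‖n‖ := by
      obtain ⟨y, -, rfl⟩ := hn
      exact (WithLp.norm_toLp_snd 2 H H y).symm
    have h6 : ‖n'.snd‖ = 0 := by
      obtain ⟨y, -, rfl⟩ := hn'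
      exact norm_zero
    have h7 := hVK v hv
    have h8 := hWK w hw
    rw [e] at h2 h4
    rw [h5] at h1
    rw [h6] at h2
    generalize RCLike.re ⟪(sndProj (H := H) + K) (v + n), v + n⟫_ℂ = q at h1 h2
    -- For the common vector x the form is at least (1/2 + δ - η)‖x‖², where δ ≤ 1/2 handles the `n`
    -- part, and at most (1/2 + η)‖x‖². Since 2η < δ, x vanishes.
    have h9 : ‖v + n‖ ^ 2 ≤ 0 := by
      have : 0 ≤ ‖n‖ ^ 2 := by positivity
      have : 0 ≤ ‖n'‖ ^ 2 := by positivity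
      have : 0 ≤ ‖v + n‖ ^ 2 := by positivity
      nlinarith
    exact norm_eq_zero.1 (pow_eq_zero_iff two_ne_zero |>.1 (le_antisymm h9 (by positivity)))
  have e1 := Submodule.finrank_sup_add_finrank_inf_eq V N
  have e2 := Submodule.finrank_sup_add_finrank_inf_eq W N'
  have e3 := Submodule.finrank_sup_add_finrank_inf_eq (V ⊔ N) (W ⊔ N')
  rw [(disjoint_double_orthogonal L hV hN).eq_bot, finrank_bot] at e1
  rw [(disjoint_double_orthogonal L' hW hN').eq_bot, finrank_bot] at e2
  rw [hdisj.eq_bot, finrank_bot] at e3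
  have e4 := Submodule.finrank_mono (sup_le (sup_le hVM hNM) (sup_le hWM hNM'))
  rw [finrank_double] at e4
  -- With m = dim M this reads dim V + (m - dim L) + dim W + (m - dim L') ≤ 2m.
  omega

end Index

/-! ### Compressions of E + K and the index they define. -/

section Compressions

open Filter Topology ContinuousLinearMap

variable {H : Type*} [NormedAddCommGroup H] [InnerProductSpace ℂ H]

theorem coe_compress_apply (Q : WithLp 2 (H × H) →L[ℂ] WithLp 2 (H × H)) (e : HilbertBasis ℕ ℂ H)
    (N : ℕ) (x : doubleSpan e N) :
    (compress Q e N x : WithLp 2 (H × H)) = (doubleSpan e N).starProjection (Q x) := rfl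

theorem inner_compress (Q : WithLp 2 (H × H) →L[ℂ] WithLp 2 (H × H)) (e : HilbertBasis ℕ ℂ H)
    (N : ℕ) (x y : doubleSpan e N) :
    ⟪compress Q e N x, y⟫_ℂ = ⟪Q x, (y : WithLp 2 (H × H))⟫_ℂ := by
  rw [Submodule.coe_inner, coe_compress_apply, Submodule.inner_starProjection_left_eq_right,
    Submodule.starProjection_eq_self_iff.2 y.2]

variable {K : WithLp 2 (H × H) →L[ℂ] WithLp 2 (H × H)} {η δ : ℝ}

/-- On the range of P, q² - q is P(Q² - Q)P - PQ(1 - P)QP. Since `sndProj` commutes with P, both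
off-diagonal factors involve only K - PKP, and their product costs η². -/
theorem norm_compress_sq_sub_le (e : HilbertBasis ℕ ℂ H) (N : ℕ)
    (hK : ‖K - (doubleSpan e N).starProjection * K * (doubleSpan e N).starProjection‖ ≤ η) :
    ‖compress (sndProj + K) e N ∘L compress (sndProj + K) e N - compress (sndProj + K) e N‖ ≤
      ‖(sndProj (H := H) + K) * (sndProj + K) - (sndProj + K)‖ + η ^ 2 := by
  refine ContinuousLinearMap.opNorm_le_bound _ (by positivity) fun x => ?_
  set Q := sndProj (H := H) + K with hQ
  set P := (doubleSpan e N).starProjection with hP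
  have hPn (y) : ‖P y‖ ≤ ‖y‖ := Submodule.norm_starProjection_apply_le _ y
  have hPx : P x = x := Submodule.starProjection_eq_self_iff.2 x.2
  have hPP (y) : P (P y) = P y :=
    Submodule.starProjection_eq_self_iff.2 (Submodule.starProjection_apply_mem _ _)
  set n := Q x - P (Q x) with hn
  have hPn0 : P n = 0 := by rw [hn, map_sub, hPP, sub_self]
  have hn1 : n = (K - P * K * P) x := by
    change Q x - P (Q x) = K x - P (K (P x))
    have h1 : P (sndProj (x : WithLp 2 (H × H))) = sndProj (x : WithLp 2 (H × H)) :=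
      Submodule.starProjection_eq_self_iff.2 (sndProj_mem_double x.2)
    rw [hPx, hQ, add_apply, map_add, h1]
    abel
  have hn2 : P (Q n) = P ((K - P * K * P) n) := by
    have h1 : P (sndProj n) = 0 := (Submodule.starProjection_apply_eq_zero_iff _).2
      (sndProj_mem_orthogonal ((Submodule.starProjection_apply_eq_zero_iff _).1 hPn0))
    change _ = P (K n - P (K (P n)))
    rw [hPn0, map_zero, map_zero, sub_zero, hQ, add_apply, map_add, h1, zero_add]
  have hn3 : ‖n‖ ≤ η * ‖x‖ := by
    rw [hn1]
    exact le_of_opNorm_le _ hK _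
  have hη : 0 ≤ η := (opNorm_nonneg _).trans hK
  have hn4 : ‖P (Q n)‖ ≤ η * (η * ‖x‖) := by
    rw [hn2]
    exact (hPn _).trans ((le_of_opNorm_le _ hK _).trans (mul_le_mul_of_nonneg_left hn3 hη))
  have key : ((compress Q e N ∘L compress Q e N - compress Q e N) x : WithLp 2 (H × H)) =
      P ((Q * Q - Q) x) - P (Q n) := by
    change P (Q (P (Q x))) - P (Q x) = P (Q (Q x) - Q x) - P (Q (Q x - P (Q x)))
    simp only [map_sub]
    abel
  rw [← Submodule.norm_coe, key]
  refine (norm_sub_le _ _).trans ?_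
  have h5 : ‖P ((Q * Q - Q) x)‖ ≤ ‖Q * Q - Q‖ * ‖x‖ := (hPn _).trans (le_opNorm _ _)
  linarith

variable [CompleteSpace H]

theorem isSymmetric_compress {Q : WithLp 2 (H × H) →L[ℂ] WithLp 2 (H × H)} (hQ : adjoint Q = Q)
    (e : HilbertBasis ℕ ℂ H) (N : ℕ) : (compress Q e N).toLinearMap.IsSymmetric := by
  intro x y
  change ⟪compress Q e N x, y⟫_ℂ = ⟪x, compress Q e N y⟫_ℂ
  rw [← inner_conj_symm x, inner_compress, inner_compress, inner_conj_symm,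
    ← adjoint_inner_right, hQ]

theorem adjoint_sndProj : adjoint (sndProj (H := H)) = sndProj := by
  symm
  rw [eq_adjoint_iff]
  intro x y
  rw [inner_sndProj, inner_sndProj_right]

/-- The dimension count is applied to the spectral space above 1/2 for (e, N), of dimension M, and
to the complementary one for (e', N'), of dimension 2N' - M'. -/
theorem countAboveHalf_sub_le (hK : adjoint K = K) (hδ0 : 0 ≤ δ) (hηδ : 2 * η < δ)
    (hδ : δ ≤ 1 / 2)
    (hQ : ‖(sndProj (H := H) + K) * (sndProj + K) - (sndProj + K)‖ + η ^ 2 ≤ 1 / 4 - δ ^ 2)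
    (e e' : HilbertBasis ℕ ℂ H) (N N' : ℕ)
    (h : ‖K - (doubleSpan e N).starProjection * K * (doubleSpan e N).starProjection‖ ≤ η)
    (h' : ‖K - (doubleSpan e' N').starProjection * K * (doubleSpan e' N').starProjection‖ ≤ η) :
    (countAboveHalf (compress (sndProj + K) e N).toLinearMap : ℤ) - N ≤
      countAboveHalf (compress (sndProj + K) e' N').toLinearMap - N' := by
  have hsa : adjoint (sndProj (H := H) + K) = sndProj + K := by rw [map_add, adjoint_sndProj, hK]
  obtain ⟨V, -, hV1, -, hV2, -⟩ := exists_spectral_splitting _ (isSymmetric_compress hsa e N) hδ0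
    ((norm_compress_sq_sub_le e N h).trans hQ)
  obtain ⟨V', W, hW1, hW2, -, hW3⟩ := exists_spectral_splitting _
    (isSymmetric_compress hsa e' N') hδ0 ((norm_compress_sq_sub_le e' N' h').trans hQ)
  have key := finrank_add_finrank_le (L := firstSpan e N) (L' := firstSpan e' N') hηδ hδ h h'
    (V := V.map (doubleSpan e N).subtype) (W := W.map (doubleSpan e' N').subtype)
    (Submodule.map_subtype_le _ _) (Submodule.map_subtype_le _ _)
    (by
      rintro _ ⟨x, hx, rfl⟩
      have := hV2 x hx
      rwa [inner_compress] at this)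
    (by
      rintro _ ⟨x, hx, rfl⟩
      have := hW3 x hx
      rwa [inner_compress] at this)
  have e1 : Module.finrank ℂ (doubleSpan e' N') = 2 * N' :=
    (finrank_double (firstSpan e' N')).trans (by rw [finrank_firstSpan])
  rw [Submodule.finrank_map_subtype_eq, Submodule.finrank_map_subtype_eq, finrank_firstSpan,
    finrank_firstSpan] at key
  omega

/-- The index of a self-adjoint almost projection that is a compact perturbation of the projection
onto the second summand. -/
theorem existsUnique_index [TopologicalSpace.SeparableSpace H] (hH : ¬ FiniteDimensional ℂ H)
    (hKc : IsCompactOperator K) (hK : adjoint K = K)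
    (hQ : ‖(sndProj (H := H) + K) * (sndProj + K) - (sndProj + K)‖ < 1 / 4) :
    ∃! ω : ℤ, ∀ e : HilbertBasis ℕ ℂ H, ∃ N₀ : ℕ, ∀ N ≥ N₀,
      ‖compress (sndProj + K) e N ∘L compress (sndProj + K) e N -
          compress (sndProj + K) e N‖ < 1 / 4 ∧
        (countAboveHalf (compress (sndProj + K) e N).toLinearMap : ℤ) - N = ω := by
  set κ := ‖(sndProj (H := H) + K) * (sndProj + K) - (sndProj + K)‖ with hκ
  have hκ0 : 0 ≤ κ := norm_nonneg _
  -- The room 1/4 - κ equals 2δ²: one δ² is kept as spectral gap, the other absorbs the compression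
  -- error η² with η = δ/3, which also satisfies 2η < δ.
  obtain ⟨δ, hδ0, hδ⟩ : ∃ δ : ℝ, 0 < δ ∧ δ ^ 2 = (1 / 4 - κ) / 2 :=
    ⟨√((1 / 4 - κ) / 2), Real.sqrt_pos.2 (by linarith), Real.sq_sqrt (by linarith)⟩
  have hδ1 : δ ≤ 1 / 2 := by nlinarith
  have hgap : κ + (δ / 3) ^ 2 ≤ 1 / 4 - δ ^ 2 := by nlinarith
  have good (e : HilbertBasis ℕ ℂ H) : ∃ N₀ : ℕ, ∀ N ≥ N₀,
      ‖K - (doubleSpan e N).starProjection * K * (doubleSpan e N).starProjection‖ ≤ δ / 3 := by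
    have := tendsto_compression (doubleSpan_mono e) (doubleSpan_dense e) hKc hK
    obtain ⟨N₀, hN₀⟩ := Metric.tendsto_atTop.1 this (δ / 3) (by positivity)
    refine ⟨N₀, fun N hN => ?_⟩
    rw [← dist_eq_norm, dist_comm]
    exact (hN₀ N hN).le
  obtain ⟨e₀⟩ := exists_hilbertBasis_nat hH
  obtain ⟨N₁, hN₁⟩ := good e₀
  refine ⟨countAboveHalf (compress (sndProj + K) e₀ N₁).toLinearMap - N₁, fun e => ?_, ?_⟩
  · obtain ⟨N₀, hN₀⟩ := good e
    refine ⟨N₀, fun N hN => ⟨?_, le_antisymm ?_ ?_⟩⟩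
    · refine (norm_compress_sq_sub_le e N (hN₀ N hN)).trans_lt ?_
      nlinarith
    · exact countAboveHalf_sub_le hK hδ0.le (by linarith) hδ1 hgap _ _ _ _ (hN₀ N hN)
        (hN₁ N₁ le_rfl)
    · exact countAboveHalf_sub_le hK hδ0.le (by linarith) hδ1 hgap _ _ _ _ (hN₁ N₁ le_rfl)
        (hN₀ N hN)
  · intro ω hω
    obtain ⟨N₀, hN₀⟩ := hω e₀
    have h1 := (hN₀ (max N₀ N₁) (le_max_left _ _)).2
    have h2 := hN₁ (max N₀ N₁) (le_max_right _ _)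
    rw [← h1]
    exact le_antisymm
      (countAboveHalf_sub_le hK hδ0.le (by linarith) hδ1 hgap _ _ _ _ h2 (hN₁ N₁ le_rfl))
      (countAboveHalf_sub_le hK hδ0.le (by linarith) hδ1 hgap _ _ _ _ (hN₁ N₁ le_rfl) h2)

end Compressions

/-! ### Passing between the two resolvents by Neumann series. -/

section Perturbation

open ContinuousLinearMap (adjoint)

variable {H : Type*} [NormedAddCommGroup H] [InnerProductSpace ℂ H] [CompleteSpace H]
  {G G' : Submodule ℂ (H × H)} {R S X : H →L[ℂ] H}

/-- A right inverse of `1 + TT*` from one of `1 + T*T`, if `T*T = TT* + X` with `‖X‖ < 1`. -/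
theorem IsResolvent.exists_dual (hR : IsResolvent G G' R S) (h : IsDualPair G G') (hX : ‖X‖ < 1)
    (hcomm : ∀ x w z, (x, w) ∈ G → (w, z) ∈ G' → ∃ w', (x, w') ∈ G' ∧ (w', z - X x) ∈ G) :
    ∃ R', IsResolvent G' G R' (adjoint S) ∧ R' = R + R * X * R' := by
  have hXR : ‖X * R‖ < 1 :=
    (norm_mul_le_of_le _ _ le_rfl (hR.norm_le_one h)).trans_lt (by linarith)
  -- Formally 1 + TT* = (1 - XR)(1 + T*T), so the inverse sought is R(1 - XR)⁻¹.
  let u := Units.oneSub (X * R) hXR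
  have hu : (1 - X * R) * ↑u⁻¹ = 1 := u.mul_inv
  refine ⟨R * ↑u⁻¹, hR.dual h fun y => ?_, ?_⟩
  · set z := (↑u⁻¹ : H →L[ℂ] H) y with hz
    have hy : z - X (R z) = y := congrArg (fun f : H →L[ℂ] H => f y) hu
    obtain ⟨w, h1, h2⟩ := hcomm _ _ _ (hR z).1 (hR z).2
    refine ⟨w, h1, ?_⟩
    convert h2 using 2
    change y - R z = _
    rw [← hy]
    abel
  · have : (↑u⁻¹ : H →L[ℂ] H) = 1 + X * R * ↑u⁻¹ := by
      rw [sub_mul, one_mul] at hu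
      rw [← hu]
      abel
    nth_rewrite 1 [this]
    simp only [mul_add, mul_one, mul_assoc]

/-- A right inverse of `1 + T*T` from one of `1 + TT*`, if `T*T = TT* + X` with `‖X‖ < 1`. -/
theorem IsResolvent.exists_of_dual {T : H →L[ℂ] H} (hR : IsResolvent G' G R T)
    (h : IsDualPair G G') (hS : ∀ y, (R y, S y) ∈ G)
    (hfun : ∀ x w w', (x, w) ∈ G → (x, w') ∈ G → w = w') (hX : ‖X‖ < 1)
    (hcomm : ∀ x w' z, (x, w') ∈ G' → (w', z - X x) ∈ G → ∃ w, (x, w) ∈ G ∧ (w, z) ∈ G') :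
    ∃ R₁ S₁, IsResolvent G G' R₁ S₁ ∧ IsResolvent G' G R (adjoint S₁) ∧ R = R₁ + R₁ * X * R ∧
      S = S₁ + S₁ * X * R := by
  have hXR : ‖-(X * R)‖ < 1 := by
    rw [norm_neg]
    exact (norm_mul_le_of_le _ _ le_rfl (hR.norm_le_one h.symm)).trans_lt (by linarith)
  -- Formally 1 + T*T = (1 + XR)(1 + TT*). Right multiplication by (1 + XR)⁻¹ yields both `R₁` and
  -- `S₁`.
  let u := Units.oneSub (-(X * R)) hXR
  have hu : (1 - -(X * R)) * ↑u⁻¹ = 1 := u.mul_inv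
  have hu' : ↑u⁻¹ * (1 - -(X * R)) = 1 := u.inv_mul
  have hres : IsResolvent G G' (R * ↑u⁻¹) (S * ↑u⁻¹) := by
    intro y
    set z := (↑u⁻¹ : H →L[ℂ] H) y with hz
    have hy : z + X (R z) = y := by
      have := congrArg (fun f : H →L[ℂ] H => f y) hu
      rwa [sub_neg_eq_add] at this
    obtain ⟨w, h1, h2⟩ := hcomm (R z) (T z) (y - R z) (hR z).1 (by
      convert (hR z).2 using 2
      rw [← hy]
      abel)
    have hw := hfun _ _ _ (hS z) h1
    refine ⟨hS z, ?_⟩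
    change (S z, y - R z) ∈ G'
    rwa [hw]
  have hmul (f : H →L[ℂ] H) : f = f * ↑u⁻¹ + f * ↑u⁻¹ * X * R := by
    calc f = f * (↑u⁻¹ * (1 - -(X * R))) := by rw [hu', mul_one]
      _ = _ := by noncomm_ring
  exact ⟨_, _, hres, hres.dual h fun y => ⟨T y, hR y⟩, hmul R, hmul S⟩

theorem existsUnique_index_blockQ [TopologicalSpace.SeparableSpace H]
    (hH : ¬ FiniteDimensional ℂ H) (hRc : IsCompactOperator R) (hR : adjoint R = R)
    (hS : IsCompactOperator (adjoint S * S))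
    (hQ : ‖blockQ R S * blockQ R S - blockQ R S‖ < 1 / 4) :
    ∃! ω : ℤ, ∀ e : HilbertBasis ℕ ℂ H, ∃ N₀ : ℕ, ∀ N ≥ N₀,
      ‖compress (blockQ R S) e N ∘L compress (blockQ R S) e N - compress (blockQ R S) e N‖ <
          1 / 4 ∧
        (countAboveHalf (compress (blockQ R S) e N).toLinearMap : ℤ) - N = ω := by
  obtain ⟨e₀⟩ := exists_hilbertBasis_nat hH
  have hSc := isCompactOperator_of_adjoint_mul e₀ hS
  have e : blockQ R S = sndProj + block R S (adjoint S) (-R) := by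
    rw [sndProj, block_add, zero_add, zero_add, zero_add, ← sub_eq_add_neg, blockQ]
  rw [e] at hQ ⊢
  refine existsUnique_index hH
    (isCompactOperator_block hRc hSc (isCompactOperator_adjoint e₀ hSc) hRc.neg) ?_ hQ
  rw [adjoint_block, map_neg, hR, ContinuousLinearMap.adjoint_adjoint]

end Perturbation

/-! ### Translation of the unbounded operators into graphs. -/

section Graphs

open LinearPMap

variable {H : Type*} [NormedAddCommGroup H] [InnerProductSpace ℂ H]

theorem mem_graph_pcomp {S T : H →ₗ.[ℂ] H} {x z : H} :
    (x, z) ∈ (pcomp S T).graph ↔ ∃ w, (x, w) ∈ T.graph ∧ (w, z) ∈ S.graph := by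
  constructor
  · intro h
    obtain ⟨⟨y, hy⟩, rfl, rfl⟩ := (mem_graph_iff _).1 h
    obtain ⟨h1, h2⟩ := mem_pcomp_domain.1 hy
    exact ⟨T ⟨y, h1⟩, T.mem_graph ⟨y, h1⟩, S.mem_graph ⟨_, h2⟩⟩
  · rintro ⟨w, h1, h2⟩
    obtain ⟨⟨y, hy⟩, rfl, rfl⟩ := (mem_graph_iff _).1 h1
    obtain ⟨⟨v, hv⟩, hv', rfl⟩ := (mem_graph_iff _).1 h2
    obtain rfl : v = T ⟨y, hy⟩ := hv'
    exact (pcomp S T).mem_graph ⟨y, mem_pcomp_domain.2 ⟨hy, hv⟩⟩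

theorem mem_graph_add_total {T : H →ₗ.[ℂ] H} {f : H →ₗ[ℂ] H} {x z : H} :
    (x, z) ∈ (T + total f).graph ↔ (x, z - f x) ∈ T.graph := by
  constructor
  · intro h
    obtain ⟨⟨y, hy⟩, rfl, rfl⟩ := (mem_graph_iff _).1 h
    convert T.mem_graph ⟨y, hy.1⟩ using 2
    change T ⟨y, hy.1⟩ + f y - f y = _
    abel
  · intro h
    obtain ⟨⟨y, hy⟩, rfl, e⟩ := (mem_graph_iff _).1 h
    convert (T + total f).mem_graph ⟨y, hy, trivial⟩ using 2
    change z = T ⟨y, hy⟩ + f y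
    rw [e]
    simp

theorem IsInverse.mem_graph {T : H →ₗ.[ℂ] H} {R : H →L[ℂ] H}
    (hR : IsInverse (total LinearMap.id + T) R) (y : H) : (R y, y - R y) ∈ T.graph := by
  obtain ⟨h, e⟩ := hR.1 y
  have hy : (R y, y) ∈ (total LinearMap.id + T).graph := by
    have := LinearPMap.mem_graph _ (⟨R y, h⟩ : (total LinearMap.id + T).domain)
    rwa [e] at this
  rw [add_comm, mem_graph_add_total] at hy
  exact hy

variable [CompleteSpace H] {A B : H →ₗ.[ℂ] H}

theorem isDualPair_graph {T : H →ₗ.[ℂ] H} (hT : Dense (T.domain : Set H)) :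
    IsDualPair T.graph T†.graph := by
  rintro ⟨a, b⟩ hp ⟨c, d⟩ hq
  obtain ⟨x, rfl, rfl⟩ := (mem_graph_iff _).1 hp
  obtain ⟨y, rfl, rfl⟩ := (mem_graph_iff _).1 hq
  exact adjoint_isFormalAdjoint hT y x

theorem dense_opC (h : IsPair A B) : Dense ((opC A B).domain : Set H) :=
  h.dense_inter.mono (le_closure (plus A B)).1

/-- The closed operator (A - iB)* extends A + iB, hence also C; taking formal adjoints reverses the
inclusion. It follows that (A+iB)(A-iB) is contained in CC*. -/
theorem minus_le_adjoint_opC (h : IsPair A B) : minus A B ≤ (opC A B)† := by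
  have hm : Dense ((minus A B).domain : Set H) := h.dense_inter
  have hle : opC A B ≤ (minus A B)† := by
    have hcl := adjoint_isClosed hm
    have hc := hcl.isClosable.leIsClosable (plus_le_adjoint h)
    refine le_of_le_graph ?_
    rw [opC, ← hc.graph_closure_eq_closure_graph]
    exact Submodule.topologicalClosure_minimal _ (le_graph_of_le (plus_le_adjoint h)) hcl
  refine IsFormalAdjoint.le_adjoint (dense_opC h) fun x y => ?_
  obtain ⟨z, hz, e⟩ := exists_of_le hle x
  have := adjoint_isFormalAdjoint hm z y
  rw [e]
  rw [← hz] at this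
  exact this

end Graphs

end BottPair

end

/-! ### Assembly for the two choices of Δ. -/

theorem mainTheorem2 {H : Type*} [NormedAddCommGroup H] [InnerProductSpace ℂ H] [CompleteSpace H]
    [TopologicalSpace.SeparableSpace H] (hH : ¬ FiniteDimensional ℂ H)
    (A B : H →ₗ.[ℂ] H) (hAB : BottPair.IsPair A B)
    (Δ : H →ₗ.[ℂ] H) (hΔ : Δ = BottPair.delta A B ∨ Δ = BottPair.delta' A B)
    (R : H →L[ℂ] H) (hR : BottPair.IsInverse Δ R) (hRc : IsCompactOperator R)
    (ε : ℝ) (hε : ε < 1) (hε' : (4 * ε - 2 * ε ^ 2) / (1 - ε) ^ 2 < 1 / 4)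
    (hcomm : BottPair.SelfCommLT (BottPair.opC A B) ε) :
    ∃! ω : ℤ, ∀ e : HilbertBasis ℕ ℂ H, ∃ N₀ : ℕ, ∀ N ≥ N₀,
      ‖BottPair.compress (BottPair.bottQ hAB hΔ hR) e N ∘L
            BottPair.compress (BottPair.bottQ hAB hΔ hR) e N -
          BottPair.compress (BottPair.bottQ hAB hΔ hR) e N‖ < 1 / 4 ∧
        (BottPair.countAboveHalf
            (BottPair.compress (BottPair.bottQ hAB hΔ hR) e N).toLinearMap : ℤ) - N = ω := by
  open BottPair ContinuousLinearMap in
  obtain ⟨X, hX, hcomm⟩ := hcomm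
  -- The hypothesis amounts to 9(1 - ε)² > 8, so ε < 1 - √(8/9) < 1/16.
  have hε16 : 4 * ε < 1 / 4 := by
    rw [div_lt_iff₀ (by nlinarith)] at hε'
    nlinarith
  have hdual := isDualPair_graph (dense_opC hAB)
  have hgraph (x z : H) : (∃ w, (x, w) ∈ (opC A B).graph ∧ (w, z) ∈ (opC A B).adjoint.graph) ↔
      ∃ w, (x, w) ∈ (opC A B).adjoint.graph ∧ (w, z - X x) ∈ (opC A B).graph := by
    rw [← mem_graph_pcomp, hcomm, mem_graph_add_total, mem_graph_pcomp]
    rfl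
  have hbott : bottQ hAB hΔ hR =
      blockQ R (closedComp (opC A B) R (opC_isClosed hAB) (inverse_mem_opC hΔ hR)) := rfl
  have hS (y : H) : (R y, closedComp (opC A B) R (opC_isClosed hAB) (inverse_mem_opC hΔ hR) y) ∈
      (opC A B).graph := (opC A B).mem_graph ⟨R y, inverse_mem_opC hΔ hR y⟩
  rw [hbott]
  generalize closedComp (opC A B) R (opC_isClosed hAB) (inverse_mem_opC hΔ hR) = S at hS ⊢
  clear hbott
  have hfun (x w w' : H) (h : (x, w) ∈ (opC A B).graph) (h' : (x, w') ∈ (opC A B).graph) :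
      w = w' := (opC A B).mem_graph_snd_inj h h' rfl
  rcases hΔ with rfl | rfl
  -- Because Δ is contained in 1 + CC*, `R` is a right inverse of 1 + CC*, and the dual estimate
  -- applies.
  · have hRy (y : H) :
        ∃ w, (R y, w) ∈ (opC A B).adjoint.graph ∧ (w, y - R y) ∈ (opC A B).graph := by
      obtain ⟨w, h1, h2⟩ := mem_graph_pcomp.1 (hR.mem_graph y)
      exact ⟨w, LinearPMap.le_graph_of_le (minus_le_adjoint_opC hAB) h1,
        LinearPMap.le_graph_of_le (LinearPMap.le_closure _) h2⟩
    have hdom (y : H) : R y ∈ (opC A B).adjoint.domain := by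
      obtain ⟨w, h1, -⟩ := hRy y
      exact LinearPMap.mem_domain_of_mem_graph h1
    have hT : IsResolvent (opC A B).adjoint.graph (opC A B).graph R
        (closedComp _ R (LinearPMap.adjoint_isClosed (dense_opC hAB)) hdom) := by
      intro y
      obtain ⟨w, h1, h2⟩ := hRy y
      have h3 := (opC A B).adjoint.mem_graph ⟨R y, hdom y⟩
      rw [(opC A B).adjoint.mem_graph_snd_inj h1 h3 rfl] at h2
      exact ⟨h3, h2⟩
    obtain ⟨R₁, S₁, h1, h2, h3, rfl⟩ := hT.exists_of_dual hdual hS hfun (hX.trans hε)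
      fun x w z hw hz => (hgraph x z).2 ⟨w, hw, hz⟩
    refine existsUnique_index_blockQ hH hRc (h2.adjoint_eq hdual.symm) ?_
      ((norm_blockQ_sq_sub_le_of_isResolvent_dual hdual h1 h2 h3 hX.le hε.le).trans_lt hε16)
    -- Now S*S = R - R² + RX*R, where every term has the compact factor R.
    rw [adjoint_mul_self_of_perturb hdual h1 h2 h3]
    exact (hRc.sub (hRc.comp_clm R)).add (hRc.clm_comp (R * adjoint X))
  · have hres : IsResolvent (opC A B).graph (opC A B).adjoint.graph R S := by
      intro y
      obtain ⟨w, h1, h2⟩ := mem_graph_pcomp.1 (hR.mem_graph y)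
      rw [hfun _ _ _ h1 (hS y)] at h2
      exact ⟨hS y, h2⟩
    obtain ⟨R', h1, h2⟩ := hres.exists_dual hdual (hX.trans hε)
      fun x w z hw hz => (hgraph x z).1 ⟨w, hw, hz⟩
    refine existsUnique_index_blockQ hH hRc (hres.adjoint_eq hdual) ?_
      ((norm_blockQ_sq_sub_le_of_isResolvent hdual hres h1 h2 hX.le).trans_lt hε16)
    rw [hres.adjoint_mul hdual]
    exact hRc.sub (hRc.comp_clm R)
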